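/- Model. An input is an array $x_1,\dots,x_n$ of elements of a linearly ordered set, accessed only through comparisons "$x_i\le x_j$?". Its sorted order is by value, with equal values in input order. A *sorted subsequence* is a nonempty set of positions whose values are nondecreasing in input order and which forms a contiguous interval of the sorted order; it is *maximal* if it is not contained in a strictly larger one. *Stable partition sort* first tests whether the given array is sorted by comparing adjacent elements, and returns it if it is; otherwise it chooses a pivot $p$ from the array, splits the remaining elements into those before and those after $p$ in sorted order, keeping the input order within each part (one comparison per element), and recurses on the two parts. A pivot rule is *$(\beta,c)$-balanced* if on every array of $m\ge1$ distinct positions of every input it uses at most $cm$ comparisons and returns an element of the array such that at most $\beta m$ elements of the array precede it and at most $\beta m$ follow it in sorted order. Let $H(p_1,\dots,p_k)=-\sum_i p_i\log_2 p_i$. **Theorem.** 1. For all real $\beta<1$ and $c$ there is a constant $C>0$ such that stable partition sort with any $(\beta,c)$-balanced pivot rule sorts every input of every size $n$, and, whenever the positions of the input are partitioned into sorted subsequences of sizes $n_1,\dots,n_k$ (so $\sum_i n_i=n$), it uses at most $$C\sum_{i=1}^k n_i\log_2\!\Big(\frac n{n_i}+1\Big)\quad\text{and at most}\quad C\Big(n\,H\Big(\frac{n_1}n,\dots,\frac{n_k}n\Big)+n\Big)$$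 comparisons. The algorithm is not given the partition or the $n_i$. 2. A $(\tfrac12,c)$-balanced pivot rule exists for some constant $c$. Hence every input consisting of sorted subsequences of sizes $n_1,\dots,n_k$ can be sorted, without knowledge of the $n_i$, with $O\big(\sum_i n_i\log(n/n_i+1)\big)=O\big(n\,H(n_1/n,\dots,n_k/n)+n\big)$ comparisons. 3. The maximal sorted subsequences of any input partition its positions, so the bounds of part 1 hold in particular for their sizes. 4. The two bounds agree up to constant factors: there is $K>0$ such that for every $n$ and every partition of $n$ positions into nonempty sets of sizes $n_1,\dots,n_k$, each of $\sum_i n_i\log_2(n/n_i+1)$ and $n\,H(n_1/n,\dots,n_k/n)+n$ is at most $K$ times the other. -/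

import Mathlib

universe u


/-- Comparison programs (decision trees) over items `ι` with results in `β`. The program
`query i j k` asks whether the key of `i` is at most the key of `j` and continues with `k b`,
where `b` is the answer; this is its only access to the keys. -/
inductive CmpProg (ι β : Type) : Type where
  | done (b : β) : CmpProg ι β
  | query (i j : ι) (k : Bool → CmpProg ι β) : CmpProg ι β

namespace CmpProg

/-- Sequential composition. -/
def bind {ι β γ : Type} : CmpProg ι β → (β → CmpProg ι γ) → CmpProg ι γ
  | done b, f => f b
  | query i j k, f => query i j (fun b => (k b).bind f)

instance {ι : Type} : Monad (CmpProg ι) where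
  pure := done
  bind := bind

/-- The result of a program on the input in which the item `i` has key `x i`. -/
def eval {ι β : Type} {α : Type*} [LinearOrder α] (x : ι → α) : CmpProg ι β → β
  | done b => b
  | query i j k => (k (decide (x i ≤ x j))).eval x

/-- The number of comparisons made by a program on the input `x`. -/
def cost {ι β : Type} {α : Type*} [LinearOrder α] (x : ι → α) : CmpProg ι β → ℕ
  | done _ => 0
  | query i j k => (k (decide (x i ≤ x j))).cost x + 1

end CmpProg

/-- The sorted order of the positions of the input `x`: by key, equal keys in input order. -/
def Precedes {n : ℕ} {α : Type*} [LinearOrder α] (x : Fin n → α) (i j : Fin n) : Prop :=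
  x i < x j ∨ (x i = x j ∧ i < j)

instance {n : ℕ} {α : Type*} [LinearOrder α] (x : Fin n → α) (i j : Fin n) :
    Decidable (Precedes x i j) := by
  unfold Precedes; infer_instance

/-- A (nonempty) set `S` of positions is a sorted subsequence of `x` if the keys at the positions
in `S` are in nondecreasing order and `S` is a contiguous interval of the sorted order. -/
def IsSortedSubseq {n : ℕ} {α : Type*} [LinearOrder α] (x : Fin n → α)
    (S : Finset (Fin n)) : Prop :=
  S.Nonempty ∧
  (∀ i ∈ S, ∀ j ∈ S, i < j → x i ≤ x j) ∧
  (∀ i ∈ S, ∀ k ∈ S, ∀ j, Precedes x i j → Precedes x j k → j ∈ S)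

/-- Test whether an array is sorted by comparing adjacent elements. -/
def checkSorted {n : ℕ} : List (Fin n) → CmpProg (Fin n) Bool
  | [] => pure true
  | [_] => pure true
  | a :: b :: l => .query a b (fun t => if t then checkSorted (b :: l) else pure false)

/-- Decide, for `i ≠ j`, whether `i` precedes `j` in the sorted order, with one comparison. -/
def comparePos {n : ℕ} (i j : Fin n) : CmpProg (Fin n) Bool :=
  if i < j then .query i j (fun t => pure t) else .query j i (fun t => pure (!t))

/-- Stable partition around the pivot `p`: the elements other than `p` that precede `p` and those
that follow `p`, each in their original relative order. -/
def stablePartition {n : ℕ} (p : Fin n) :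
    List (Fin n) → CmpProg (Fin n) (List (Fin n) × List (Fin n))
  | [] => pure ([], [])
  | y :: l =>
    if y = p then stablePartition p l
    else do
      let t ← comparePos y p
      let r ← stablePartition p l
      pure (if t then (y :: r.1, r.2) else (r.1, y :: r.2))

/-- A pivot rule: `piv n a l` is a comparison program that chooses a pivot for the nonempty
array `a :: l` of positions of an input of size `n`. -/
abbrev PivotRule : Type := (n : ℕ) → Fin n → List (Fin n) → CmpProg (Fin n) (Fin n)

/-- Stable partition sort with early termination. The first argument bounds the recursion
depth; the length of the array always suffices, as each call removes the pivot. -/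
def partitionSortAux (piv : PivotRule) {n : ℕ} :
    ℕ → List (Fin n) → CmpProg (Fin n) (List (Fin n))
  | 0, A => pure A
  | _ + 1, [] => pure []
  | d + 1, a :: l => do
    let t ← checkSorted (a :: l)
    if t then pure (a :: l)
    else do
      let p ← piv n a l
      let r ← stablePartition p (a :: l)
      let lo ← partitionSortAux piv d r.1
      let hi ← partitionSortAux piv d r.2
      pure (lo ++ p :: hi)

/-- Stable partition sort of an input of size `n`; it returns the positions in sorted order. -/
def partitionSort (piv : PivotRule) (n : ℕ) : CmpProg (Fin n) (List (Fin n)) :=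
  partitionSortAux piv n (List.finRange n)

/-- On every array of `m` elements the rule uses at most `c * m` comparisons and returns an
element of the array such that at most `β * m` elements precede it and at most `β * m` follow it
in sorted order. -/
def IsBalancedPivotRule (piv : PivotRule) (β c : ℝ) : Prop :=
  ∀ (n : ℕ) (α : Type u) [LinearOrder α] (x : Fin n → α) (a : Fin n) (l : List (Fin n)),
    (a :: l).Nodup →
    let A := a :: l
    let p := (piv n a l).eval x
    p ∈ A ∧
    ((A.filter (fun y => decide (Precedes x y p))).length : ℝ) ≤ β * (A.length : ℝ) ∧
    ((A.filter (fun y => decide (Precedes x p y))).length : ℝ) ≤ β * (A.length : ℝ) ∧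
    ((piv n a l).cost x : ℝ) ≤ c * (A.length : ℝ)

/-- `∑ nᵢ log₂ (n / nᵢ + 1)`, where the `nᵢ` are the sizes of the parts of `P`. -/
noncomputable def sizeBound {n : ℕ} (P : Finpartition (Finset.univ : Finset (Fin n))) : ℝ :=
  ∑ S ∈ P.parts, (S.card : ℝ) * Real.logb 2 ((n : ℝ) / (S.card : ℝ) + 1)

/-- The binary entropy `H (n₁ / n, …, nₖ / n)`, where the `nᵢ` are the sizes of the parts. -/
noncomputable def sizeEntropy {n : ℕ} (P : Finpartition (Finset.univ : Finset (Fin n))) : ℝ :=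
  -∑ S ∈ P.parts, ((S.card : ℝ) / (n : ℝ)) * Real.logb 2 ((S.card : ℝ) / (n : ℝ))

/-!
Each element of an unsorted array that the recursion visits pays for a constant number of
comparisons, so it suffices to bound, for every sorted subsequence `S` of size `s`, how often
elements of `S` are visited. An array that meets `S` but contains no element beyond an end of `S`
is part of `S`, hence already sorted and free. Each of the two ends of `S` is crossed by at most
one array on every level of the recursion, and on level `j` this array has at most `β ^ j * n`
elements. So the visits number at most `2 ∑ⱼ min s (β ^ j * n)`, and this is
`O (s log (n / s + 1))`: the terms with `j ≤ log (n / s) / log (1 / β)` are at most `s`, the others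
form a geometric series.
-/

namespace CmpProg

variable {ι β γ : Type} {α : Type*} [LinearOrder α] (x : ι → α)

@[simp] theorem eval_pure (b : β) : (pure b : CmpProg ι β).eval x = b := rfl

@[simp] theorem cost_pure (b : β) : (pure b : CmpProg ι β).cost x = 0 := rfl

@[simp] theorem eval_query (i j : ι) (k : Bool → CmpProg ι β) :
    (query i j k).eval x = (k (decide (x i ≤ x j))).eval x := rfl

@[simp] theorem cost_query (i j : ι) (k : Bool → CmpProg ι β) :
    (query i j k).cost x = (k (decide (x i ≤ x j))).cost x + 1 := rfl

@[simp] theorem eval_bind (m : CmpProg ι β) (f : β → CmpProg ι γ) :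
    (m >>= f).eval x = (f (m.eval x)).eval x := by
  change (m.bind f).eval x = _
  induction m with
  | done b => rfl
  | query _ _ _ ih => exact ih _

@[simp] theorem cost_bind (m : CmpProg ι β) (f : β → CmpProg ι γ) :
    (m >>= f).cost x = m.cost x + (f (m.eval x)).cost x := by
  change (m.bind f).cost x = _
  induction m with
  | done b => simp only [CmpProg.bind, cost, eval, zero_add]
  | query i j k ih =>
    simp only [CmpProg.bind, cost, eval, ih]
    omega

end CmpProg

section SortedOrder

variable {n : ℕ} {α : Type*} [LinearOrder α] {x : Fin n → α} {i j : Fin n}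

theorem precedes_iff_toLex_lt : Precedes x i j ↔ toLex (x i, i) < toLex (x j, j) := by
  rw [Prod.Lex.toLex_lt_toLex]
  rfl

theorem not_precedes_self : ¬ Precedes x i i := by
  simp only [precedes_iff_toLex_lt, lt_self_iff_false, not_false_eq_true]

theorem Precedes.trans {k : Fin n} (hij : Precedes x i j) (hjk : Precedes x j k) :
    Precedes x i k := by
  rw [precedes_iff_toLex_lt] at *
  exact hij.trans hjk

theorem Precedes.asymm (h : Precedes x i j) : ¬ Precedes x j i :=
  fun h' => not_precedes_self (h.trans h')

theorem Precedes.ne (h : Precedes x i j) : i ≠ j := by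
  rintro rfl
  exact not_precedes_self h

theorem Precedes.le (h : Precedes x i j) : x i ≤ x j :=
  h.elim le_of_lt fun h => h.1.le

theorem precedes_trichotomy (x : Fin n → α) (i j : Fin n) :
    Precedes x i j ∨ i = j ∨ Precedes x j i := by
  simp only [precedes_iff_toLex_lt]
  exact (lt_trichotomy _ _).imp_right (Or.imp_left fun h => congrArg Prod.snd (toLex.injective h))

theorem precedes_of_lt_of_le (hij : i < j) (hx : x i ≤ x j) : Precedes x i j :=
  hx.lt_or_eq.imp_right fun h => ⟨h, hij⟩

end SortedOrder

section SortedSubsequences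

variable {n : ℕ} {α : Type*} [LinearOrder α] {x : Fin n → α}

theorem isSortedSubseq_singleton (x : Fin n → α) (i : Fin n) : IsSortedSubseq x {i} := by
  refine ⟨Finset.singleton_nonempty i, ?_, ?_⟩ <;> simp only [Finset.mem_singleton]
  · rintro _ rfl _ rfl h
    exact absurd h (lt_irrefl _)
  · rintro _ rfl _ rfl j h h'
    exact absurd h' h.asymm

theorem forall_lt_imp_le_iff_forall_precedes_imp_lt {S : Finset (Fin n)} :
    (∀ i ∈ S, ∀ j ∈ S, i < j → x i ≤ x j) ↔ ∀ i ∈ S, ∀ j ∈ S, Precedes x i j → i < j := by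
  constructor
  · intro h i hi j hj hij
    by_contra! hji
    have hji := lt_of_le_of_ne hji hij.ne.symm
    exact hij.asymm (precedes_of_lt_of_le hji (h j hj i hi hji))
  · intro h i hi j hj hij
    by_contra! hx
    exact hij.asymm (h j hj i hi (.inl hx))

namespace IsSortedSubseq

variable {S T : Finset (Fin n)} {i j k e : Fin n}

theorem mem_of_precedes (hS : IsSortedSubseq x S) (hi : i ∈ S) (hk : k ∈ S)
    (hij : Precedes x i j) (hjk : Precedes x j k) : j ∈ S :=
  hS.2.2 i hi k hk j hij hjk

theorem lt_of_precedes (hS : IsSortedSubseq x S) (hi : i ∈ S) (hj : j ∈ S)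
    (hij : Precedes x i j) : i < j :=
  forall_lt_imp_le_iff_forall_precedes_imp_lt.1 hS.2.1 i hi j hj hij

theorem precedes_all_or_all_precede (hS : IsSortedSubseq x S) (hj : j ∉ S) :
    (∀ s ∈ S, Precedes x j s) ∨ ∀ s ∈ S, Precedes x s j := by
  by_contra! h
  obtain ⟨⟨s, hs, hjs⟩, t, ht, htj⟩ := h
  have hsj := ((precedes_trichotomy x j s).resolve_left hjs).resolve_left fun h => hj (h ▸ hs)
  have hjt := ((precedes_trichotomy x t j).resolve_left htj).resolve_left fun h => hj (h ▸ ht)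
  exact hj (hS.mem_of_precedes hs ht hsj hjt)

theorem pairwise_le (hS : IsSortedSubseq x S) {A : List (Fin n)} (hA : A.Pairwise (· < ·))
    (hAS : ∀ y ∈ A, y ∈ S) : A.Pairwise fun i j => x i ≤ x j :=
  hA.imp_of_mem fun hi hj hij => hS.2.1 _ (hAS _ hi) _ (hAS _ hj) hij

theorem lt_of_precedes_of_mem_inter (hS : IsSortedSubseq x S) (hT : IsSortedSubseq x T)
    (heS : e ∈ S) (heT : e ∈ T) (hi : i ∈ S) (hj : j ∈ T) (hij : Precedes x i j) : i < j := by
  rcases precedes_trichotomy x e i with hei | rfl | hie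
  · exact hT.lt_of_precedes (hT.mem_of_precedes heT hj hei hij) hj hij
  · exact hT.lt_of_precedes heT hj hij
  rcases precedes_trichotomy x e j with hej | rfl | hje
  · exact (hS.lt_of_precedes hi heS hie).trans (hT.lt_of_precedes heT hj hej)
  · exact hS.lt_of_precedes hi heS hij
  · exact hS.lt_of_precedes hi (hS.mem_of_precedes hi heS hij hje) hij

theorem mem_union_of_precedes (hS : IsSortedSubseq x S) (hT : IsSortedSubseq x T)
    (heS : e ∈ S) (heT : e ∈ T) (hi : i ∈ S) (hk : k ∈ T) (hij : Precedes x i j)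
    (hjk : Precedes x j k) : j ∈ S ∪ T := by
  rw [Finset.mem_union]
  rcases precedes_trichotomy x e j with hej | rfl | hje
  exacts [.inr (hT.mem_of_precedes heT hk hej hjk), .inl heS,
    .inl (hS.mem_of_precedes hi heS hij hje)]

theorem union (hS : IsSortedSubseq x S) (hT : IsSortedSubseq x T) (heS : e ∈ S) (heT : e ∈ T) :
    IsSortedSubseq x (S ∪ T) := by
  refine ⟨⟨e, Finset.mem_union_left T heS⟩, forall_lt_imp_le_iff_forall_precedes_imp_lt.2 ?_, ?_⟩
  · intro i hi j hj hij
    rcases Finset.mem_union.1 hi with hi | hi <;> rcases Finset.mem_union.1 hj with hj | hj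
    exacts [hS.lt_of_precedes hi hj hij, hS.lt_of_precedes_of_mem_inter hT heS heT hi hj hij,
      hT.lt_of_precedes_of_mem_inter hS heT heS hi hj hij, hT.lt_of_precedes hi hj hij]
  · intro i hi k hk j hij hjk
    rcases Finset.mem_union.1 hi with hi | hi <;> rcases Finset.mem_union.1 hk with hk | hk
    · exact Finset.mem_union_left T (hS.mem_of_precedes hi hk hij hjk)
    · exact hS.mem_union_of_precedes hT heS heT hi hk hij hjk
    · exact Finset.union_comm T S ▸ hT.mem_union_of_precedes hS heT heS hi hk hij hjk
    · exact Finset.mem_union_right S (hT.mem_of_precedes hi hk hij hjk)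

end IsSortedSubseq

theorem existsUnique_maximal_isSortedSubseq (x : Fin n → α) (i : Fin n) :
    ∃! S, Maximal (IsSortedSubseq x) S ∧ i ∈ S := by
  obtain ⟨S, hiS, hS⟩ := Finite.exists_le_maximal (isSortedSubseq_singleton x i)
  replace hiS : i ∈ S := hiS (Finset.mem_singleton_self i)
  refine ⟨S, ⟨hS, hiS⟩, fun T ⟨hT, hiT⟩ => ?_⟩
  have hST := hS.prop.union hT.prop hiS hiT
  exact (hT.eq_of_le hST Finset.subset_union_right).trans
    (hS.eq_of_le hST Finset.subset_union_left).symm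

theorem exists_finpartition_maximal_isSortedSubseq (x : Fin n → α) :
    ∃ P : Finpartition (Finset.univ : Finset (Fin n)),
      ∀ S, S ∈ P.parts ↔ Maximal (IsSortedSubseq x) S := by
  classical
  refine ⟨Finpartition.ofExistsUnique {S | Maximal (IsSortedSubseq x) S}
    (fun S _ => S.subset_univ) (fun i _ => ?_) (fun h => ?_), fun S => ?_⟩
  · simpa only [Finset.mem_filter_univ] using existsUnique_maximal_isSortedSubseq x i
  · exact Finset.not_nonempty_empty ((Finset.mem_filter_univ _).1 h).prop.1
  · exact Finset.mem_filter_univ S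

end SortedSubsequences

section Partitioning

variable {n : ℕ} {α : Type*} [LinearOrder α] {x : Fin n → α}

theorem eval_comparePos (x : Fin n → α) (i j : Fin n) :
    (comparePos i j).eval x = decide (Precedes x i j) := by
  unfold comparePos Precedes
  split_ifs with hij
  · simp [hij, le_iff_lt_or_eq]
  · simp [hij, ← not_lt]

@[simp] theorem cost_comparePos (x : Fin n → α) (i j : Fin n) :
    (comparePos i j).cost x = 1 := by
  unfold comparePos
  split_ifs <;> rfl

theorem eval_checkSorted (x : Fin n → α) (A : List (Fin n)) :
    (checkSorted A).eval x = decide (A.Pairwise fun i j => x i ≤ x j) := by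
  have : IsTrans (Fin n) fun i j => x i ≤ x j := ⟨fun _ _ _ => le_trans⟩
  simp only [← List.isChain_iff_pairwise]
  fun_induction checkSorted A with
  | case1 | case2 => simp
  | case3 a b l ih => by_cases h : x a ≤ x b <;> simp [h, ih]

theorem cost_checkSorted_le (x : Fin n → α) (A : List (Fin n)) :
    (checkSorted A).cost x ≤ A.length := by
  fun_induction checkSorted A with
  | case1 | case2 => simp
  | case3 a b l ih =>
    by_cases h : x a ≤ x b
    · simpa [h] using ih
    · simp [h]

/-- The subarray of the elements of `A` that precede `p` in the sorted order, as returned by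
`stablePartition`. -/
def lowerPart (x : Fin n → α) (p : Fin n) (A : List (Fin n)) : List (Fin n) :=
  A.filter fun y => decide (Precedes x y p)

/-- The subarray of the elements of `A` that follow `p` in the sorted order, as returned by
`stablePartition`. -/
def upperPart (x : Fin n → α) (p : Fin n) (A : List (Fin n)) : List (Fin n) :=
  A.filter fun y => decide (Precedes x p y)

variable {p y : Fin n} {A : List (Fin n)}

@[simp] theorem mem_lowerPart : y ∈ lowerPart x p A ↔ y ∈ A ∧ Precedes x y p := by
  simp only [lowerPart, List.mem_filter, decide_eq_true_eq]

@[simp] theorem mem_upperPart : y ∈ upperPart x p A ↔ y ∈ A ∧ Precedes x p y := by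
  simp only [upperPart, List.mem_filter, decide_eq_true_eq]

theorem lowerPart_sublist (x : Fin n → α) (p : Fin n) (A : List (Fin n)) :
    (lowerPart x p A).Sublist A := List.filter_sublist

theorem upperPart_sublist (x : Fin n → α) (p : Fin n) (A : List (Fin n)) :
    (upperPart x p A).Sublist A := List.filter_sublist

theorem lowerPart_append_upperPart_perm (x : Fin n → α) (hA : A.Nodup) (hp : p ∈ A) :
    (lowerPart x p A ++ p :: upperPart x p A).Perm A := by
  refine (List.perm_ext_iff_of_nodup ?_ hA).2 fun y => ?_
  · refine List.nodup_append.2 ⟨hA.sublist (lowerPart_sublist x p A), List.nodup_cons.2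
      ⟨fun h => not_precedes_self (mem_upperPart.1 h).2, hA.sublist (upperPart_sublist x p A)⟩, ?_⟩
    rintro y hy z hz rfl
    have hyp := (mem_lowerPart.1 hy).2
    rcases List.mem_cons.1 hz with rfl | hz
    exacts [not_precedes_self hyp, hyp.asymm (mem_upperPart.1 hz).2]
  · simp only [List.mem_append, List.mem_cons, mem_lowerPart, mem_upperPart]
    have := precedes_trichotomy x y p
    grind

theorem length_lowerPart_add_length_upperPart (x : Fin n → α) (hA : A.Nodup) (hp : p ∈ A) :
    (lowerPart x p A).length + (upperPart x p A).length + 1 = A.length := by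
  rw [← (lowerPart_append_upperPart_perm x hA hp).length_eq, List.length_append, List.length_cons,
    add_assoc]

@[simp] theorem eval_stablePartition (x : Fin n → α) (p : Fin n) (A : List (Fin n)) :
    (stablePartition p A).eval x = (lowerPart x p A, upperPart x p A) := by
  fun_induction stablePartition p A with
  | case1 => rfl
  | case2 l ih => simp [ih, lowerPart, upperPart, not_precedes_self]
  | case3 y l hy ih =>
    rw [CmpProg.eval_bind, CmpProg.eval_bind, CmpProg.eval_pure, ih, eval_comparePos]
    rcases (precedes_trichotomy x y p).imp_right (Or.resolve_left · hy) with h | h <;>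
      simp [h, lowerPart, upperPart, h.asymm]

theorem cost_stablePartition_le (x : Fin n → α) (p : Fin n) (A : List (Fin n)) :
    (stablePartition p A).cost x ≤ A.length := by
  fun_induction stablePartition p A with
  | case1 => exact le_rfl
  | case2 l ih => exact ih.trans (Nat.le_succ _)
  | case3 y l _ ih =>
    simp only [CmpProg.cost_bind, cost_comparePos, CmpProg.cost_pure, List.length_cons]
    omega

end Partitioning

section PartitionSort

variable {n : ℕ} {α : Type*} [LinearOrder α] {piv : PivotRule} {x : Fin n → α}

/-- The pivot that the rule `piv` chooses on the array `a :: l` of the input `x`. -/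
def pivotOf (piv : PivotRule) (x : Fin n → α) (a : Fin n) (l : List (Fin n)) : Fin n :=
  (piv n a l).eval x

theorem eval_partitionSortAux_succ (piv : PivotRule) (x : Fin n → α) (d : ℕ) (a : Fin n)
    (l : List (Fin n)) :
    (partitionSortAux piv (d + 1) (a :: l)).eval x =
      if (a :: l).Pairwise fun i j => x i ≤ x j then a :: l
      else (partitionSortAux piv d (lowerPart x (pivotOf piv x a l) (a :: l))).eval x ++
        pivotOf piv x a l ::
          (partitionSortAux piv d (upperPart x (pivotOf piv x a l) (a :: l))).eval x := by
  rw [partitionSortAux, CmpProg.eval_bind, eval_checkSorted]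
  split_ifs <;> simp_all [pivotOf]

theorem cost_partitionSortAux_succ (piv : PivotRule) (x : Fin n → α) (d : ℕ) (a : Fin n)
    (l : List (Fin n)) :
    (partitionSortAux piv (d + 1) (a :: l)).cost x = (checkSorted (a :: l)).cost x +
      if (a :: l).Pairwise fun i j => x i ≤ x j then 0
      else (piv n a l).cost x + (stablePartition (pivotOf piv x a l) (a :: l)).cost x +
        (partitionSortAux piv d (lowerPart x (pivotOf piv x a l) (a :: l))).cost x +
        (partitionSortAux piv d (upperPart x (pivotOf piv x a l) (a :: l))).cost x := by
  rw [partitionSortAux, CmpProg.cost_bind, eval_checkSorted]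
  split_ifs <;> simp_all [pivotOf, add_assoc]

theorem partitionSortAux_perm
    (hpiv : ∀ (a : Fin n) (l : List (Fin n)), (a :: l).Nodup → pivotOf piv x a l ∈ a :: l)
    {d : ℕ} {A : List (Fin n)} (hd : A.length ≤ d) (hA : A.Nodup) :
    ((partitionSortAux piv d A).eval x).Perm A := by
  induction d generalizing A with
  | zero =>
    obtain rfl := List.length_eq_zero_iff.1 (Nat.le_zero.1 hd)
    exact .refl _
  | succ d ih =>
    obtain _ | ⟨a, l⟩ := A
    · exact .refl _
    rw [eval_partitionSortAux_succ]
    split_ifs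
    · exact .refl _
    have hp := hpiv a l hA
    have hlen := length_lowerPart_add_length_upperPart x hA hp
    have hlo := ih (by omega) (hA.sublist (lowerPart_sublist x (pivotOf piv x a l) _))
    have hhi := ih (by omega) (hA.sublist (upperPart_sublist x (pivotOf piv x a l) _))
    exact (hlo.append (hhi.cons _)).trans (lowerPart_append_upperPart_perm x hA hp)

theorem partitionSortAux_pairwise_le
    (hpiv : ∀ (a : Fin n) (l : List (Fin n)), (a :: l).Nodup → pivotOf piv x a l ∈ a :: l)
    {d : ℕ} {A : List (Fin n)} (hd : A.length ≤ d) (hA : A.Nodup) :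
    ((partitionSortAux piv d A).eval x).Pairwise fun i j => x i ≤ x j := by
  induction d generalizing A with
  | zero =>
    obtain rfl := List.length_eq_zero_iff.1 (Nat.le_zero.1 hd)
    exact .nil
  | succ d ih =>
    obtain _ | ⟨a, l⟩ := A
    · exact .nil
    rw [eval_partitionSortAux_succ]
    split_ifs with hsorted
    · exact hsorted
    have hlen := length_lowerPart_add_length_upperPart x hA (hpiv a l hA)
    set p := pivotOf piv x a l
    have hdlo : (lowerPart x p (a :: l)).length ≤ d := by omega
    have hdhi : (upperPart x p (a :: l)).length ≤ d := by omega
    have hndlo := hA.sublist (lowerPart_sublist x p _)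
    have hndhi := hA.sublist (upperPart_sublist x p _)
    have hle : ∀ y ∈ (partitionSortAux piv d (lowerPart x p (a :: l))).eval x, x y ≤ x p :=
      fun y hy => (mem_lowerPart.1 ((partitionSortAux_perm hpiv hdlo hndlo).mem_iff.1 hy)).2.le
    have hge : ∀ z ∈ (partitionSortAux piv d (upperPart x p (a :: l))).eval x, x p ≤ x z :=
      fun z hz => (mem_upperPart.1 ((partitionSortAux_perm hpiv hdhi hndhi).mem_iff.1 hz)).2.le
    refine List.pairwise_append.2 ⟨ih hdlo hndlo, List.pairwise_cons.2 ⟨hge, ih hdhi hndhi⟩, ?_⟩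
    intro y hy z hz
    rcases List.mem_cons.1 hz with rfl | hz
    exacts [hle y hy, (hle y hy).trans (hge z hz)]

/-- The concatenation of all unsorted arrays met in the recursion of `partitionSortAux`: a position
occurs in it once for every such array that contains the position. -/
def unsortedVisits (piv : PivotRule) (x : Fin n → α) : ℕ → List (Fin n) → List (Fin n)
  | 0, _ => []
  | _ + 1, [] => []
  | d + 1, a :: l =>
    if (a :: l).Pairwise fun i j => x i ≤ x j then []
    else a :: l ++ (unsortedVisits piv x d (lowerPart x (pivotOf piv x a l) (a :: l)) ++
      unsortedVisits piv x d (upperPart x (pivotOf piv x a l) (a :: l)))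

end PartitionSort

section BalancedPivots

variable {n : ℕ} {α : Type u} [LinearOrder α] {piv : PivotRule} {β c : ℝ}

namespace IsBalancedPivotRule

theorem pivotOf_mem (hpiv : IsBalancedPivotRule.{u} piv β c) (x : Fin n → α) (a : Fin n)
    (l : List (Fin n)) (hA : (a :: l).Nodup) : pivotOf piv x a l ∈ a :: l :=
  (hpiv n α x a l hA).1

theorem length_lowerPart_le (hpiv : IsBalancedPivotRule.{u} piv β c) (x : Fin n → α) {a : Fin n}
    {l : List (Fin n)} (hA : (a :: l).Nodup) :
    ((lowerPart x (pivotOf piv x a l) (a :: l)).length : ℝ) ≤ β * ((a :: l).length : ℝ) :=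
  (hpiv n α x a l hA).2.1

theorem length_upperPart_le (hpiv : IsBalancedPivotRule.{u} piv β c) (x : Fin n → α) {a : Fin n}
    {l : List (Fin n)} (hA : (a :: l).Nodup) :
    ((upperPart x (pivotOf piv x a l) (a :: l)).length : ℝ) ≤ β * ((a :: l).length : ℝ) :=
  (hpiv n α x a l hA).2.2.1

theorem cost_le (hpiv : IsBalancedPivotRule.{u} piv β c) (x : Fin n → α) {a : Fin n}
    {l : List (Fin n)} (hA : (a :: l).Nodup) :
    ((piv n a l).cost x : ℝ) ≤ c * ((a :: l).length : ℝ) :=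
  (hpiv n α x a l hA).2.2.2

theorem mono {β' c' : ℝ} (hpiv : IsBalancedPivotRule.{u} piv β c) (hβ : β ≤ β') (hc : c ≤ c') :
    IsBalancedPivotRule.{u} piv β' c' := by
  intro n α _ x a l hA
  obtain ⟨hp, hlo, hhi, hcost⟩ := hpiv n α x a l hA
  exact ⟨hp, hlo.trans (by gcongr), hhi.trans (by gcongr), hcost.trans (by gcongr)⟩

end IsBalancedPivotRule

theorem cost_partitionSortAux_le (hpiv : IsBalancedPivotRule.{u} piv β c) (x : Fin n → α) (d : ℕ)
    {A : List (Fin n)} (hA : A.Nodup) :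
    ((partitionSortAux piv d A).cost x : ℝ) ≤
      (c + 2) * (unsortedVisits piv x d A).length + A.length := by
  fun_induction unsortedVisits piv x d A with
  | case1 A => simp [partitionSortAux]
  | case2 d => simp [partitionSortAux]
  | case3 d a l hsorted =>
    rw [cost_partitionSortAux_succ, if_pos hsorted, add_zero]
    simpa using mod_cast cost_checkSorted_le x (a :: l)
  | case4 d a l hsorted ihlo ihhi =>
    rw [cost_partitionSortAux_succ, if_neg hsorted]
    set p := pivotOf piv x a l
    have hcheck : ((checkSorted (a :: l)).cost x : ℝ) ≤ (a :: l).length :=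
      mod_cast cost_checkSorted_le x _
    have hpart : ((stablePartition p (a :: l)).cost x : ℝ) ≤ (a :: l).length :=
      mod_cast cost_stablePartition_le x p _
    have hlen : ((lowerPart x p (a :: l)).length : ℝ) + (upperPart x p (a :: l)).length + 1 =
        (a :: l).length :=
      mod_cast length_lowerPart_add_length_upperPart x hA (hpiv.pivotOf_mem x a l hA)
    have hpivot := hpiv.cost_le x hA
    specialize ihlo (hA.sublist (lowerPart_sublist x p _))
    specialize ihhi (hA.sublist (upperPart_sublist x p _))
    rw [List.length_append, List.length_append]
    push_cast only [Nat.cast_add]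
    linarith

end BalancedPivots

section Crossings

variable {n : ℕ} {α : Type*} [LinearOrder α] {x : Fin n → α} {S : Finset (Fin n)} {p : Fin n}
  {A B : List (Fin n)}

/-- The array `A` crosses the lower end of `S`: it meets `S` and has an element below all of `S`. -/
def CrossesBottom (x : Fin n → α) (S : Finset (Fin n)) (A : List (Fin n)) : Prop :=
  (∃ s ∈ A, s ∈ S) ∧ ∃ y ∈ A, ∀ s ∈ S, Precedes x y s

/-- The array `A` crosses the upper end of `S`: it meets `S` and has an element above all of `S`. -/
def CrossesTop (x : Fin n → α) (S : Finset (Fin n)) (A : List (Fin n)) : Prop :=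
  (∃ s ∈ A, s ∈ S) ∧ ∃ y ∈ A, ∀ s ∈ S, Precedes x s y

open Classical in
/-- The number of ends of `S` that the array `A` crosses. It controls how often the elements of `S`
are visited when `A` is sorted. -/
noncomputable def crossings (x : Fin n → α) (S : Finset (Fin n)) (A : List (Fin n)) : ℕ :=
  (if CrossesBottom x S A then 1 else 0) + if CrossesTop x S A then 1 else 0

theorem CrossesBottom.of_sublist (h : CrossesBottom x S A) (hAB : A.Sublist B) :
    CrossesBottom x S B :=
  let ⟨⟨s, hsA, hsS⟩, y, hyA, hyS⟩ := h
  ⟨⟨s, hAB.subset hsA, hsS⟩, y, hAB.subset hyA, hyS⟩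

theorem CrossesTop.of_sublist (h : CrossesTop x S A) (hAB : A.Sublist B) : CrossesTop x S B :=
  let ⟨⟨s, hsA, hsS⟩, y, hyA, hyS⟩ := h
  ⟨⟨s, hAB.subset hsA, hsS⟩, y, hAB.subset hyA, hyS⟩

theorem CrossesBottom.not_crossesBottom_upperPart (h : CrossesBottom x S (lowerPart x p A)) :
    ¬ CrossesBottom x S (upperPart x p B) := by
  obtain ⟨s, hs, hsS⟩ := h.1
  rintro ⟨-, y, hy, hyS⟩
  exact ((mem_upperPart.1 hy).2.trans (hyS s hsS)).asymm (mem_lowerPart.1 hs).2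

theorem CrossesTop.not_crossesTop_upperPart (h : CrossesTop x S (lowerPart x p A)) :
    ¬ CrossesTop x S (upperPart x p B) := by
  obtain ⟨y, hy, hyS⟩ := h.2
  rintro ⟨⟨s, hs, hsS⟩, -⟩
  exact ((mem_upperPart.1 hs).2.trans (hyS s hsS)).asymm (mem_lowerPart.1 hy).2

theorem crossings_lowerPart_add_crossings_upperPart_le (x : Fin n → α) (S : Finset (Fin n))
    (p : Fin n) (A : List (Fin n)) :
    crossings x S (lowerPart x p A) + crossings x S (upperPart x p A) ≤ crossings x S A := by
  have hlo := lowerPart_sublist x p A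
  have hhi := upperPart_sublist x p A
  have hbot := fun h : CrossesBottom x S (lowerPart x p A) =>
    h.not_crossesBottom_upperPart (B := A)
  have htop := fun h : CrossesTop x S (lowerPart x p A) => h.not_crossesTop_upperPart (B := A)
  have hbotlo := fun h : CrossesBottom x S (lowerPart x p A) => h.of_sublist hlo
  have hbothi := fun h : CrossesBottom x S (upperPart x p A) => h.of_sublist hhi
  have htoplo := fun h : CrossesTop x S (lowerPart x p A) => h.of_sublist hlo
  have htophi := fun h : CrossesTop x S (upperPart x p A) => h.of_sublist hhi
  unfold crossings
  grind

theorem crossings_le_two (x : Fin n → α) (S : Finset (Fin n)) (A : List (Fin n)) :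
    crossings x S A ≤ 2 := by
  unfold crossings
  split_ifs <;> norm_num

theorem countP_mem_le_card {ι : Type*} [DecidableEq ι] {A : List ι} (hA : A.Nodup)
    (S : Finset ι) : A.countP (· ∈ S) ≤ S.card := by
  rw [List.countP_eq_length_filter, ← List.toFinset_card_of_nodup (hA.filter _)]
  refine Finset.card_le_card fun y hy => ?_
  simpa only [decide_eq_true_eq] using (List.mem_filter.1 (List.mem_toFinset.1 hy)).2

theorem IsSortedSubseq.countP_mem_eq_zero_of_crossings_eq_zero (hS : IsSortedSubseq x S)
    (hA : A.Pairwise (· < ·)) (hunsorted : ¬ A.Pairwise fun i j => x i ≤ x j)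
    (hcross : crossings x S A = 0) : A.countP (· ∈ S) = 0 := by
  simp only [List.countP_eq_zero, decide_eq_true_eq]
  intro s hsA hsS
  refine hunsorted (hS.pairwise_le hA fun y hyA => ?_)
  by_contra hyS
  unfold crossings at hcross
  rcases hS.precedes_all_or_all_precede hyS with h | h
  · have : CrossesBottom x S A := ⟨⟨s, hsA, hsS⟩, y, hyA, h⟩
    simp [this] at hcross
  · have : CrossesTop x S A := ⟨⟨s, hsA, hsS⟩, y, hyA, h⟩
    simp [this] at hcross

theorem IsSortedSubseq.countP_mem_le_crossings_mul_min (hS : IsSortedSubseq x S)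
    (hA : A.Pairwise (· < ·)) (hunsorted : ¬ A.Pairwise fun i j => x i ≤ x j) :
    A.countP (· ∈ S) ≤ crossings x S A * min S.card A.length := by
  rcases Nat.eq_zero_or_pos (crossings x S A) with hcross | hcross
  · rw [hS.countP_mem_eq_zero_of_crossings_eq_zero hA hunsorted hcross]
    exact Nat.zero_le _
  · exact (le_min (countP_mem_le_card (hA.imp ne_of_lt) S) List.countP_le_length).trans
      (Nat.le_mul_of_pos_left _ hcross)

end Crossings

section LevelSum

/-- The most visits that the elements of a set of size `s` can receive from a nested sequence of
arrays, one on each level of the recursion, if the array on level `j` has at most `β ^ j * m`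
elements. -/
noncomputable def levelSum (β s m : ℝ) : ℝ := ∑' j : ℕ, min s (β ^ j * m)

variable {β s m m' : ℝ}

theorem summable_min_pow_mul (hβ₀ : 0 ≤ β) (hβ₁ : β < 1) (hs : 0 ≤ s) (hm : 0 ≤ m) :
    Summable fun j : ℕ => min s (β ^ j * m) :=
  .of_nonneg_of_le (fun _ => le_min hs (by positivity)) (fun _ => min_le_right _ _)
    ((summable_geometric_of_lt_one hβ₀ hβ₁).mul_right m)

theorem levelSum_nonneg (hβ₀ : 0 ≤ β) (hs : 0 ≤ s) (hm : 0 ≤ m) : 0 ≤ levelSum β s m :=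
  tsum_nonneg fun _ => le_min hs (by positivity)

theorem levelSum_mono (hβ₀ : 0 ≤ β) (hβ₁ : β < 1) (hs : 0 ≤ s) (hm : 0 ≤ m) (hmm' : m ≤ m') :
    levelSum β s m ≤ levelSum β s m' :=
  (summable_min_pow_mul hβ₀ hβ₁ hs hm).tsum_le_tsum (fun _ => by gcongr)
    (summable_min_pow_mul hβ₀ hβ₁ hs (hm.trans hmm'))

theorem levelSum_eq_min_add (hβ₀ : 0 ≤ β) (hβ₁ : β < 1) (hs : 0 ≤ s) (hm : 0 ≤ m) :
    levelSum β s m = min s m + levelSum β s (β * m) := by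
  rw [levelSum, (summable_min_pow_mul hβ₀ hβ₁ hs hm).tsum_eq_zero_add, pow_zero, one_mul]
  simp only [levelSum, pow_succ, mul_assoc]

theorem mul_min_add_mul_levelSum_le (hβ₀ : 0 ≤ β) (hβ₁ : β < 1) (hs : 0 ≤ s) {m₁ m₂ k k₁ k₂ : ℝ}
    (hm₁ : 0 ≤ m₁) (hm₂ : 0 ≤ m₂) (hm : 0 ≤ m) (hm₁' : m₁ ≤ β * m) (hm₂' : m₂ ≤ β * m)
    (hk₁ : 0 ≤ k₁) (hk₂ : 0 ≤ k₂) (hk : k₁ + k₂ ≤ k) :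
    k * min s m + (k₁ * levelSum β s m₁ + k₂ * levelSum β s m₂) ≤ k * levelSum β s m := by
  have hG : 0 ≤ levelSum β s (β * m) := levelSum_nonneg hβ₀ hs (mul_nonneg hβ₀ hm)
  rw [levelSum_eq_min_add hβ₀ hβ₁ hs hm, mul_add]
  gcongr
  calc k₁ * levelSum β s m₁ + k₂ * levelSum β s m₂
      ≤ k₁ * levelSum β s (β * m) + k₂ * levelSum β s (β * m) := by
        gcongr
        exacts [levelSum_mono hβ₀ hβ₁ hs hm₁ hm₁', levelSum_mono hβ₀ hβ₁ hs hm₂ hm₂']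
    _ ≤ k * levelSum β s (β * m) := by
        rw [← add_mul]
        gcongr

theorem levelSum_le (hβ₀ : 0 ≤ β) (hβ₁ : β < 1) (hs : 0 ≤ s) (hm : 0 ≤ m) (t : ℕ) :
    levelSum β s m ≤ t * s + β ^ t * m * (1 - β)⁻¹ := by
  have hsum := summable_min_pow_mul hβ₀ hβ₁ hs hm
  have hgeom : HasSum (fun j : ℕ => β ^ t * m * β ^ j) (β ^ t * m * (1 - β)⁻¹) :=
    (hasSum_geometric_of_lt_one hβ₀ hβ₁).mul_left _
  rw [levelSum, ← hsum.sum_add_tsum_nat_add t]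
  gcongr
  · calc ∑ j ∈ Finset.range t, min s (β ^ j * m) ≤ ∑ _j ∈ Finset.range t, s :=
          Finset.sum_le_sum fun _ _ => min_le_left _ _
      _ = t * s := by rw [Finset.sum_const, Finset.card_range, nsmul_eq_mul]
  · refine (((summable_nat_add_iff t).2 hsum).tsum_le_tsum (fun j => ?_) hgeom.summable).trans_eq
      hgeom.tsum_eq
    exact (min_le_right _ _).trans_eq (by ring)

theorem logb_le_logb_add_one {r : ℝ} (hr : 1 ≤ r) : Real.logb 2 r ≤ Real.logb 2 (r + 1) :=
  Real.logb_le_logb_of_le one_lt_two (by linarith) (by linarith)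

theorem one_le_logb_add_one {r : ℝ} (hr : 1 ≤ r) : 1 ≤ Real.logb 2 (r + 1) := by
  rw [Real.le_logb_iff_rpow_le one_lt_two (by linarith), Real.rpow_one]
  linarith

theorem logb_add_one_le {r : ℝ} (hr : 1 ≤ r) : Real.logb 2 (r + 1) ≤ Real.logb 2 r + 1 := by
  calc Real.logb 2 (r + 1) ≤ Real.logb 2 (r * 2) :=
        Real.logb_le_logb_of_le one_lt_two (by linarith) (by linarith)
    _ = Real.logb 2 r + 1 := by
        rw [Real.logb_mul (by linarith) two_ne_zero, Real.logb_self_eq_one one_lt_two]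

theorem exists_levelSum_le_mul_logb (hβ₀ : 0 < β) (hβ₁ : β < 1) :
    ∃ K : ℝ, 0 < K ∧ ∀ s m : ℝ, 0 < s → s ≤ m →
      levelSum β s m ≤ K * (s * Real.logb 2 (m / s + 1)) := by
  have hlog : 0 < Real.logb β⁻¹ 2 := Real.logb_pos (one_lt_inv₀ hβ₀ |>.2 hβ₁) one_lt_two
  have hgeom : 0 < (1 - β)⁻¹ := inv_pos.2 (sub_pos.2 hβ₁)
  refine ⟨Real.logb β⁻¹ 2 + 1 + (1 - β)⁻¹, by positivity, fun s m hs hsm => ?_⟩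
  have hr : 1 ≤ m / s := (one_le_div hs).2 hsm
  set ℓ := Real.logb 2 (m / s + 1)
  have hℓ : 1 ≤ ℓ := one_le_logb_add_one hr
  set t := ⌈Real.logb β⁻¹ (m / s)⌉₊
  have ht : t ≤ Real.logb β⁻¹ 2 * ℓ + 1 := by
    have hbase : Real.logb β⁻¹ (m / s) = Real.logb β⁻¹ 2 * Real.logb 2 (m / s) :=
      (Real.mul_logb two_ne_zero (by norm_num) (by norm_num)).symm
    calc (t : ℝ) ≤ Real.logb β⁻¹ (m / s) + 1 :=
          (Nat.ceil_lt_add_one (Real.logb_nonneg (one_lt_inv₀ hβ₀ |>.2 hβ₁) hr)).le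
      _ ≤ Real.logb β⁻¹ 2 * ℓ + 1 := by
          rw [hbase]
          gcongr
          exact logb_le_logb_add_one hr
  have htail : β ^ t * m ≤ s := by
    have hpow : m / s ≤ β⁻¹ ^ t := by
      rw [← Real.rpow_natCast, ← Real.logb_le_iff_le_rpow (one_lt_inv₀ hβ₀ |>.2 hβ₁) (by linarith)]
      exact Nat.le_ceil _
    rwa [inv_pow, div_le_iff₀ hs, ← div_eq_inv_mul, le_div_iff₀' (by positivity)] at hpow
  calc levelSum β s m ≤ t * s + β ^ t * m * (1 - β)⁻¹ :=
        levelSum_le hβ₀.le hβ₁ hs.le (hs.le.trans hsm) t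
    _ ≤ (Real.logb β⁻¹ 2 * ℓ + ℓ) * s + s * ℓ * (1 - β)⁻¹ := by
        refine add_le_add (mul_le_mul_of_nonneg_right (by linarith) hs.le)
          (mul_le_mul_of_nonneg_right ?_ hgeom.le)
        exact htail.trans (le_mul_of_one_le_right hs.le hℓ)
    _ = _ := by ring

end LevelSum

section SizeBounds

theorem sum_countP_mem_parts {ι : Type*} [Fintype ι] [DecidableEq ι]
    (P : Finpartition (Finset.univ : Finset ι)) (A : List ι) :
    ∑ S ∈ P.parts, A.countP (· ∈ S) = A.length := by
  induction A with
  | nil => simp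
  | cons a l ih =>
    obtain ⟨T, ⟨hT, haT⟩, hunique⟩ := P.existsUnique_mem (Finset.mem_univ a)
    have hone : ∑ S ∈ P.parts, (if a ∈ S then 1 else 0) = 1 := by
      rw [Finset.sum_eq_single_of_mem T hT fun S hS hST =>
        if_neg fun haS => hST (hunique S ⟨hS, haS⟩), if_pos haT]
    simp only [List.countP_cons, decide_eq_true_eq, Finset.sum_add_distrib, ih, hone,
      List.length_cons]

variable {n : ℕ} (P : Finpartition (Finset.univ : Finset (Fin n))) {S : Finset (Fin n)}

variable {P} in
theorem card_pos_of_mem_parts (hS : S ∈ P.parts) : 0 < (S.card : ℝ) :=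
  mod_cast (P.nonempty_of_mem_parts hS).card_pos

theorem cast_card_le (S : Finset (Fin n)) : (S.card : ℝ) ≤ n :=
  mod_cast card_finset_fin_le S

variable {P} in
theorem one_le_div_card (hS : S ∈ P.parts) : 1 ≤ (n : ℝ) / S.card :=
  (one_le_div (card_pos_of_mem_parts hS)).2 (cast_card_le S)

theorem sum_cast_card_parts : ∑ S ∈ P.parts, (S.card : ℝ) = n :=
  mod_cast P.sum_card_parts.trans (Finset.card_fin n)

theorem le_sizeBound : (n : ℝ) ≤ sizeBound P :=
  (sum_cast_card_parts P).symm.trans_le <| Finset.sum_le_sum fun _ hS =>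
    le_mul_of_one_le_right (Nat.cast_nonneg _) (one_le_logb_add_one (one_le_div_card hS))

theorem mul_sizeEntropy : (n : ℝ) * sizeEntropy P =
    ∑ S ∈ P.parts, (S.card : ℝ) * Real.logb 2 ((n : ℝ) / S.card) := by
  rw [sizeEntropy, ← Finset.sum_neg_distrib, Finset.mul_sum]
  refine Finset.sum_congr rfl fun S hS => ?_
  have hn : (n : ℝ) ≠ 0 := ((card_pos_of_mem_parts hS).trans_le (cast_card_le S)).ne'
  rw [← inv_div, Real.logb_inv]
  field_simp

theorem mul_sizeEntropy_add : (n : ℝ) * sizeEntropy P + n =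
    ∑ S ∈ P.parts, (S.card : ℝ) * (Real.logb 2 ((n : ℝ) / S.card) + 1) := by
  simp only [mul_add, mul_one, Finset.sum_add_distrib, sum_cast_card_parts, mul_sizeEntropy]

theorem sizeBound_le_mul_sizeEntropy_add : sizeBound P ≤ (n : ℝ) * sizeEntropy P + n := by
  rw [mul_sizeEntropy_add, sizeBound]
  gcongr with S hS
  exact logb_add_one_le (one_le_div_card hS)

theorem mul_sizeEntropy_add_le_two_mul_sizeBound :
    (n : ℝ) * sizeEntropy P + n ≤ 2 * sizeBound P := by
  rw [mul_sizeEntropy_add, sizeBound, Finset.mul_sum]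
  refine Finset.sum_le_sum fun S hS => ?_
  have hr := one_le_div_card hS
  rw [mul_left_comm, two_mul]
  exact mul_le_mul_of_nonneg_left
    (add_le_add (logb_le_logb_add_one hr) (one_le_logb_add_one hr)) (Nat.cast_nonneg _)

end SizeBounds

section PartitionSortCost

variable {n : ℕ} {α : Type u} [LinearOrder α] {x : Fin n → α} {piv : PivotRule} {β c : ℝ}

theorem countP_mem_unsortedVisits_le (hpiv : IsBalancedPivotRule.{u} piv β c) (hβ₀ : 0 ≤ β)
    (hβ₁ : β < 1) {S : Finset (Fin n)} (hS : IsSortedSubseq x S) (d : ℕ) {A : List (Fin n)}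
    (hA : A.Pairwise (· < ·)) :
    ((unsortedVisits piv x d A).countP (· ∈ S) : ℝ) ≤
      crossings x S A * levelSum β S.card A.length := by
  have hnonneg (A : List (Fin n)) : 0 ≤ crossings x S A * levelSum β S.card A.length :=
    mul_nonneg (Nat.cast_nonneg _) (levelSum_nonneg hβ₀ (Nat.cast_nonneg _) (Nat.cast_nonneg _))
  fun_induction unsortedVisits piv x d A with
  | case1 A => simpa using hnonneg A
  | case2 => simpa using hnonneg []
  | case3 _ a l => simpa using hnonneg (a :: l)
  | case4 d a l hunsorted ihlo ihhi =>
    have hnodup : (a :: l).Nodup := hA.imp ne_of_lt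
    specialize ihlo (hA.sublist (lowerPart_sublist x _ _))
    specialize ihhi (hA.sublist (upperPart_sublist x _ _))
    have hlo := hpiv.length_lowerPart_le x hnodup
    have hhi := hpiv.length_upperPart_le x hnodup
    have hcross : (crossings x S (lowerPart x (pivotOf piv x a l) (a :: l)) : ℝ) +
        crossings x S (upperPart x (pivotOf piv x a l) (a :: l)) ≤ crossings x S (a :: l) :=
      mod_cast crossings_lowerPart_add_crossings_upperPart_le x S _ _
    have hcount : ((a :: l).countP (· ∈ S) : ℝ) ≤
        crossings x S (a :: l) * min (S.card : ℝ) (a :: l).length :=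
      mod_cast hS.countP_mem_le_crossings_mul_min hA hunsorted
    rw [List.countP_append, List.countP_append, Nat.cast_add, Nat.cast_add]
    exact (add_le_add hcount (add_le_add ihlo ihhi)).trans
      (mul_min_add_mul_levelSum_le hβ₀ hβ₁ (Nat.cast_nonneg _) (Nat.cast_nonneg _)
        (Nat.cast_nonneg _) (Nat.cast_nonneg _) hlo hhi (Nat.cast_nonneg _) (Nat.cast_nonneg _)
        hcross)

theorem exists_cost_partitionSort_le (hβ : β < 1) (c : ℝ) :
    ∃ C : ℝ, 0 < C ∧ ∀ piv : PivotRule, IsBalancedPivotRule.{u} piv β c →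
      ∀ (n : ℕ) (α : Type u) [LinearOrder α] (x : Fin n → α)
        (P : Finpartition (Finset.univ : Finset (Fin n))),
        (∀ S ∈ P.parts, IsSortedSubseq x S) →
        ((partitionSort piv n).cost x : ℝ) ≤ C * sizeBound P := by
  have hβ₀ : 0 < max β (1 / 2) := lt_max_of_lt_right one_half_pos
  have hβ₁ : max β (1 / 2) < 1 := max_lt hβ one_half_lt_one
  obtain ⟨K, hK, hlevel⟩ := exists_levelSum_le_mul_logb hβ₀ hβ₁
  refine ⟨(max c 0 + 2) * (2 * K) + 1, by positivity, fun piv hpiv n α _ x P hP => ?_⟩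
  replace hpiv := hpiv.mono (le_max_left β (1 / 2)) (le_max_left c 0)
  set V := unsortedVisits piv x n (List.finRange n)
  have hpart : ∀ S ∈ P.parts, (V.countP (· ∈ S) : ℝ) ≤
      2 * (K * (S.card * Real.logb 2 (n / S.card + 1))) := fun S hS => by
    have hvisits := countP_mem_unsortedVisits_le hpiv hβ₀.le hβ₁ (hP S hS) n
      (List.pairwise_lt_finRange n)
    rw [List.length_finRange] at hvisits
    refine hvisits.trans (mul_le_mul (mod_cast crossings_le_two x S _)
      (hlevel _ _ (card_pos_of_mem_parts hS) (cast_card_le S)) ?_ zero_le_two)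
    exact levelSum_nonneg hβ₀.le (Nat.cast_nonneg _) (Nat.cast_nonneg _)
  have hvisits : (V.length : ℝ) ≤ 2 * K * sizeBound P := by
    rw [← sum_countP_mem_parts P V, Nat.cast_sum, sizeBound, Finset.mul_sum]
    exact Finset.sum_le_sum fun S hS => (hpart S hS).trans_eq (mul_assoc _ _ _).symm
  calc ((partitionSort piv n).cost x : ℝ) ≤ (max c 0 + 2) * V.length + n := by
        simpa only [partitionSort, List.length_finRange] using
          cost_partitionSortAux_le hpiv x n (List.nodup_finRange n)
    _ ≤ (max c 0 + 2) * (2 * K * sizeBound P) + sizeBound P := by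
        gcongr
        exact le_sizeBound P
    _ = _ := by ring

end PartitionSortCost

section Selection

variable {n : ℕ}

/-- Insertion of the position `y` into a list that is in sorted order. -/
def insertPos (y : Fin n) : List (Fin n) → CmpProg (Fin n) (List (Fin n))
  | [] => pure [y]
  | z :: l => do
    let t ← comparePos y z
    if t then pure (y :: z :: l)
    else do
      let r ← insertPos y l
      pure (z :: r)

/-- Insertion sort, used on arrays of bounded length. -/
def insertionSort : List (Fin n) → CmpProg (Fin n) (List (Fin n))
  | [] => pure []
  | y :: l => do
    let r ← insertionSort l
    insertPos y r

/-- The medians of consecutive groups of five elements; up to four last elements are ignored. -/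
def groupMedians : List (Fin n) → CmpProg (Fin n) (List (Fin n))
  | a :: b :: c :: d :: e :: l => do
    let s ← insertionSort [a, b, c, d, e]
    let r ← groupMedians l
    pure (s.getD 2 a :: r)
  | _ => pure []

/-- Selection of the element of rank `k` by the median of medians. The first natural number bounds
the recursion depth, and `a` is a default value. -/
def select (a : Fin n) : ℕ → ℕ → List (Fin n) → CmpProg (Fin n) (Fin n)
  | 0, _, _ => pure a
  | d + 1, k, A =>
    if A.length < 24 then do
      let s ← insertionSort A
      pure (s.getD k a)
    else do
      let M ← groupMedians A
      let p ← select a d (M.length / 2) M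
      let r ← stablePartition p A
      if k < r.1.length then select a d k r.1
      else if k = r.1.length then pure p
      else select a d (k - r.1.length - 1) r.2

/-- The pivot rule that selects the median. -/
def medianPivot : PivotRule := fun _ a l =>
  select a (a :: l).length ((a :: l).length / 2) (a :: l)

variable {α : Type*} [LinearOrder α] {x : Fin n → α}

theorem insertPos_perm (x : Fin n → α) (y : Fin n) (l : List (Fin n)) :
    ((insertPos y l).eval x).Perm (y :: l) := by
  induction l with
  | nil => exact .refl _
  | cons z l ih =>
    rw [insertPos, CmpProg.eval_bind]
    split_ifs
    · exact .refl _
    · simpa using (ih.cons z).trans (.swap y z l)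

theorem insertPos_pairwise {y : Fin n} {l : List (Fin n)} (hy : y ∉ l)
    (hl : l.Pairwise (Precedes x)) : ((insertPos y l).eval x).Pairwise (Precedes x) := by
  induction l with
  | nil => exact List.pairwise_singleton _ y
  | cons z l ih =>
    obtain ⟨hyz, hyl⟩ := not_or.1 (List.mem_cons.not.1 hy)
    obtain ⟨hz, hl'⟩ := List.pairwise_cons.1 hl
    rw [insertPos, CmpProg.eval_bind, eval_comparePos]
    split_ifs with h <;> rw [decide_eq_true_iff] at h
    · refine List.pairwise_cons.2 ⟨fun w hw => ?_, hl⟩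
      rcases List.mem_cons.1 hw with rfl | hw
      exacts [h, h.trans (hz w hw)]
    · have hzy := ((precedes_trichotomy x y z).resolve_left h).resolve_left hyz
      rw [CmpProg.eval_bind, CmpProg.eval_pure]
      refine List.pairwise_cons.2 ⟨fun w hw => ?_, ih hyl hl'⟩
      rcases List.mem_cons.1 ((insertPos_perm x y l).mem_iff.1 hw) with rfl | hw
      exacts [hzy, hz w hw]

theorem cost_insertPos_le (x : Fin n → α) (y : Fin n) (l : List (Fin n)) :
    (insertPos y l).cost x ≤ l.length := by
  induction l with
  | nil => exact le_rfl
  | cons z l ih =>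
    rw [insertPos, CmpProg.cost_bind, cost_comparePos, List.length_cons, add_comm]
    split_ifs
    · simp
    · simpa using ih

theorem insertionSort_perm (x : Fin n → α) (l : List (Fin n)) :
    ((insertionSort l).eval x).Perm l := by
  induction l with
  | nil => exact .refl _
  | cons y l ih =>
    rw [insertionSort, CmpProg.eval_bind]
    exact (insertPos_perm x y _).trans (ih.cons y)

theorem insertionSort_pairwise (x : Fin n → α) {l : List (Fin n)} (hl : l.Nodup) :
    ((insertionSort l).eval x).Pairwise (Precedes x) := by
  induction l with
  | nil => exact .nil
  | cons y l ih =>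
    rw [insertionSort, CmpProg.eval_bind]
    obtain ⟨hy, hl⟩ := List.nodup_cons.1 hl
    exact insertPos_pairwise (fun h => hy ((insertionSort_perm x l).mem_iff.1 h)) (ih hl)

theorem cost_insertionSort_le (x : Fin n → α) (l : List (Fin n)) :
    (insertionSort l).cost x ≤ l.length * l.length := by
  induction l with
  | nil => exact le_rfl
  | cons y l ih =>
    have h := cost_insertPos_le x y ((insertionSort l).eval x)
    rw [(insertionSort_perm x l).length_eq] at h
    rw [insertionSort, CmpProg.cost_bind, List.length_cons]
    linarith

section Rank

variable {A B : List (Fin n)} {p q : Fin n} {k : ℕ}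

/-- `p` is the element of `A` with rank `k` in the sorted order, counted from zero. -/
def HasRank (x : Fin n → α) (A : List (Fin n)) (k : ℕ) (p : Fin n) : Prop :=
  p ∈ A ∧ (lowerPart x p A).length = k

theorem HasRank.perm (h : HasRank x A k p) (hAB : A.Perm B) : HasRank x B k p :=
  ⟨hAB.mem_iff.1 h.1, (hAB.filter _).length_eq.symm.trans h.2⟩

theorem hasRank_getElem (hA : A.Pairwise (Precedes x)) (hk : k < A.length) :
    HasRank x A k A[k] := by
  refine ⟨List.getElem_mem hk, ?_⟩
  induction A generalizing k with
  | nil => exact absurd hk (Nat.not_lt_zero k)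
  | cons b l ih =>
    obtain ⟨hb, hl⟩ := List.pairwise_cons.1 hA
    cases k with
    | zero =>
      rw [List.getElem_cons_zero, List.length_eq_zero_iff, lowerPart, List.filter_eq_nil_iff]
      simpa [not_precedes_self] using fun y hy => (hb y hy).asymm
    | succ k =>
      have hk : k < l.length := Nat.lt_of_succ_lt_succ hk
      have hbk : Precedes x b l[k] := hb _ (List.getElem_mem hk)
      simpa [lowerPart, hbk] using ih hl hk

theorem HasRank.of_lowerPart (h : HasRank x (lowerPart x p A) k q) : HasRank x A k q := by
  obtain ⟨hqA, hqp⟩ := mem_lowerPart.1 h.1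
  refine ⟨hqA, ?_⟩
  rw [← h.2, lowerPart, lowerPart, lowerPart, List.filter_filter]
  congr 2 with y
  simpa using fun hyq : Precedes x y q => hyq.trans hqp

theorem HasRank.of_upperPart (hA : A.Nodup) (hp : p ∈ A) (h : HasRank x (upperPart x p A) k q) :
    HasRank x A ((lowerPart x p A).length + 1 + k) q := by
  have hpq := (mem_upperPart.1 h.1).2
  have hlower : (lowerPart x p A).filter (fun y => decide (Precedes x y q)) = lowerPart x p A :=
    List.filter_eq_self.2 fun y hy => decide_eq_true ((mem_lowerPart.1 hy).2.trans hpq)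
  refine HasRank.perm ⟨by simp [h.1], ?_⟩ (lowerPart_append_upperPart_perm x hA hp)
  rw [lowerPart, List.filter_append, hlower, List.filter_cons_of_pos (by simpa using hpq),
    List.length_append, List.length_cons, ← h.2, add_assoc, add_comm 1]
  rfl

theorem HasRank.length_upperPart (hA : A.Nodup) (h : HasRank x A k p) :
    (upperPart x p A).length + k + 1 = A.length := by
  rw [← length_lowerPart_add_length_upperPart x hA h.1, h.2, add_comm k]

end Rank

theorem length_eval_groupMedians (x : Fin n → α) (A : List (Fin n)) :
    ((groupMedians A).eval x).length = A.length / 5 := by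
  fun_induction groupMedians A with
  | case1 a b c d e l ih =>
    simp only [CmpProg.eval_bind, CmpProg.eval_pure, List.length_cons, ih]
    omega
  | case2 A hA =>
    suffices A.length < 5 from (Nat.div_eq_of_lt this).symm
    rcases A with _ | ⟨a, _ | ⟨b, _ | ⟨c, _ | ⟨d, _ | ⟨e, l⟩⟩⟩⟩⟩
    case cons.cons.cons.cons.cons => exact absurd rfl (hA a b c d e l)
    all_goals simp

theorem cost_groupMedians_le (x : Fin n → α) (A : List (Fin n)) :
    (groupMedians A).cost x ≤ 25 * (A.length / 5) := by
  fun_induction groupMedians A with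
  | case1 a b c d e l ih =>
    have hsort : (insertionSort [a, b, c, d, e]).cost x ≤ 25 := cost_insertionSort_le x _
    simp only [CmpProg.cost_bind, CmpProg.cost_pure, List.length_cons]
    omega
  | case2 => exact Nat.zero_le _

theorem groupMedians_subperm (x : Fin n → α) (A : List (Fin n)) :
    ((groupMedians A).eval x).Subperm A := by
  fun_induction groupMedians A with
  | case1 a b c d e l ih =>
    have hperm := insertionSort_perm x [a, b, c, d, e]
    have hlen : 2 < ((insertionSort [a, b, c, d, e]).eval x).length := by simp [hperm.length_eq]
    rw [CmpProg.eval_bind, CmpProg.eval_bind, CmpProg.eval_pure, List.getD_eq_getElem _ _ hlen]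
    have hmem := hperm.mem_iff.1 (List.getElem_mem hlen)
    exact (List.singleton_subperm_iff.2 hmem).append ih
  | case2 => exact List.nil_subperm

theorem nodup_eval_groupMedians (x : Fin n → α) {A : List (Fin n)} (hA : A.Nodup) :
    ((groupMedians A).eval x).Nodup :=
  let ⟨_, hperm, hsub⟩ := groupMedians_subperm x A
  hperm.nodup_iff.1 (hA.sublist hsub)

theorem add_one_le_countP_of_getElem {ι : Type*} {R : ι → ι → Prop} {q : ι → Bool} {s : List ι}
    (hs : s.Pairwise R) (hq : ∀ y z, R y z → q z → q y) {k : ℕ} (hk : k < s.length)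
    (hqk : q s[k]) : k + 1 ≤ s.countP q := by
  have hall : ∀ y ∈ s.take (k + 1), q y := by
    intro y hy
    obtain ⟨i, hi, rfl⟩ := List.getElem_of_mem hy
    rw [List.length_take, lt_min_iff, Nat.lt_succ_iff] at hi
    rw [List.getElem_take]
    rcases hi.1.lt_or_eq with hik | rfl
    exacts [hq _ _ (List.pairwise_iff_getElem.1 hs _ _ hi.2 hk hik) hqk, hqk]
  calc k + 1 = (s.take (k + 1)).countP q := by
        rw [List.countP_eq_length.2 hall, List.length_take, min_eq_left (Nat.succ_le_of_lt hk)]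
    _ ≤ s.countP q := (List.take_sublist _ _).countP_le

theorem three_mul_countP_groupMedians_le {q : Fin n → Bool}
    (hq : (∀ y z, Precedes x y z → q z → q y) ∨ ∀ y z, Precedes x y z → q y → q z)
    {A : List (Fin n)} (hA : A.Nodup) :
    3 * ((groupMedians A).eval x).countP q ≤ A.countP q := by
  fun_induction groupMedians A with
  | case1 a b c d e l ih =>
    obtain ⟨hgroup, hl, -⟩ := (List.nodup_append (l₁ := [a, b, c, d, e])).1 hA
    have hperm := insertionSort_perm x [a, b, c, d, e]
    have hsorted := insertionSort_pairwise x hgroup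
    have hcount : (a :: b :: c :: d :: e :: l).countP q =
        ((insertionSort [a, b, c, d, e]).eval x).countP q + l.countP q := by
      rw [hperm.countP_eq, ← List.countP_append]
      rfl
    rw [CmpProg.eval_bind, CmpProg.eval_bind, CmpProg.eval_pure, List.countP_cons, hcount]
    specialize ih hl
    have hlen : ((insertionSort [a, b, c, d, e]).eval x).length = 5 := hperm.length_eq
    generalize (insertionSort [a, b, c, d, e]).eval x = s at *
    rw [List.getD_eq_getElem s a (by omega : 2 < s.length)]
    split_ifs with hmedian
    · have : 3 ≤ s.countP q := by
        rcases hq with hq | hq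
        · exact add_one_le_countP_of_getElem hsorted hq _ hmedian
        · rw [← s.countP_reverse]
          refine add_one_le_countP_of_getElem (List.pairwise_reverse.2 hsorted)
            (fun y z hzy => hq z y hzy) (k := 2) (by simp [hlen]) ?_
          simpa [List.getElem_reverse, hlen] using hmedian
      omega
    · omega
  | case2 => exact Nat.zero_le _

theorem three_mul_length_groupMedians_add_length_lowerPart_le (x : Fin n → α) (p : Fin n)
    {A : List (Fin n)} (hA : A.Nodup) :
    3 * ((groupMedians A).eval x).length + (lowerPart x p A).length ≤
      3 * (lowerPart x p ((groupMedians A).eval x)).length + A.length := by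
  have hcount := three_mul_countP_groupMedians_le (x := x) (q := fun y => !decide (Precedes x y p))
    (.inr fun y z hyz => by simpa using fun hy hzp => hy (hyz.trans hzp)) hA
  have hM := List.length_eq_countP_add_countP (fun y => decide (Precedes x y p))
    (l := (groupMedians A).eval x)
  have hAcount := List.length_eq_countP_add_countP (fun y => decide (Precedes x y p)) (l := A)
  simp only [lowerPart, ← List.countP_eq_length_filter, decide_not, Bool.decide_eq_true]
    at hcount hM hAcount ⊢
  omega

theorem three_mul_length_groupMedians_add_length_upperPart_le (x : Fin n → α) (p : Fin n)
    {A : List (Fin n)} (hA : A.Nodup) :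
    3 * ((groupMedians A).eval x).length + (upperPart x p A).length ≤
      3 * (upperPart x p ((groupMedians A).eval x)).length + A.length := by
  have hcount := three_mul_countP_groupMedians_le (x := x) (q := fun y => !decide (Precedes x p y))
    (.inl fun y z hyz => by simpa using fun hz hpy => hz (hpy.trans hyz)) hA
  have hM := List.length_eq_countP_add_countP (fun y => decide (Precedes x p y))
    (l := (groupMedians A).eval x)
  have hAcount := List.length_eq_countP_add_countP (fun y => decide (Precedes x p y)) (l := A)
  simp only [upperPart, ← List.countP_eq_length_filter, decide_not, Bool.decide_eq_true]
    at hcount hM hAcount ⊢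
  omega

section MedianOfMedians

variable {A : List (Fin n)} {p : Fin n}

theorem HasRank.ten_mul_length_lowerPart_le (hA : A.Nodup)
    (hp : HasRank x ((groupMedians A).eval x) (A.length / 5 / 2) p) :
    10 * (lowerPart x p A).length ≤ 7 * A.length + 12 := by
  have h := three_mul_length_groupMedians_add_length_lowerPart_le x p hA
  rw [hp.2, length_eval_groupMedians] at h
  omega

theorem HasRank.ten_mul_length_upperPart_le (hA : A.Nodup)
    (hp : HasRank x ((groupMedians A).eval x) (A.length / 5 / 2) p) :
    10 * (upperPart x p A).length ≤ 7 * A.length + 12 := by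
  have h := three_mul_length_groupMedians_add_length_upperPart_le x p hA
  have hM := hp.length_upperPart (nodup_eval_groupMedians x hA)
  rw [length_eval_groupMedians] at h hM
  omega

theorem hasRank_select (a : Fin n) {d k : ℕ} (hd : A.length ≤ d) (hA : A.Nodup)
    (hk : k < A.length) : HasRank x A k ((select a d k A).eval x) := by
  induction d generalizing k A with
  | zero => omega
  | succ d ih =>
    rw [select]
    split_ifs with hsmall
    · have hperm := insertionSort_perm x A
      rw [CmpProg.eval_bind, CmpProg.eval_pure, List.getD_eq_getElem _ _ (hperm.length_eq ▸ hk)]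
      exact (hasRank_getElem (insertionSort_pairwise x hA) _).perm hperm
    have hM := groupMedians_subperm x A
    have hMnodup := nodup_eval_groupMedians x hA
    have hlenM := length_eval_groupMedians x A
    have hp := ih (A := (groupMedians A).eval x) (k := A.length / 5 / 2) (by omega) hMnodup
      (by omega)
    simp only [CmpProg.eval_bind, eval_stablePartition, hlenM]
    generalize (select a d (A.length / 5 / 2) ((groupMedians A).eval x)).eval x = p at *
    have hpA : p ∈ A := hM.subset hp.1
    have hlen := length_lowerPart_add_length_upperPart x hA hpA
    split_ifs with hlo hmid
    · exact (ih (by omega) (hA.sublist (lowerPart_sublist x p A)) hlo).of_lowerPart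
    · exact ⟨hpA, hmid.symm⟩
    · have hhi := ih (k := k - (lowerPart x p A).length - 1) (by omega)
        (hA.sublist (upperPart_sublist x p A)) (by omega)
      convert hhi.of_upperPart hA hpA using 1
      omega

/-- The worst-case cost `T m` on arrays of `m` elements satisfies
`T m ≤ 6 * m + T (m / 5) + T ((7 * m + 12) / 10)`, and `T m ≤ 120 * m` follows by induction once
`24 ≤ m`, the threshold of `select`. -/
theorem cost_select_le (x : Fin n → α) (a : Fin n) {d : ℕ} (k : ℕ) (hd : A.length ≤ d)
    (hA : A.Nodup) : (select a d k A).cost x ≤ 120 * A.length := by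
  induction d generalizing k A with
  | zero => exact Nat.zero_le _
  | succ d ih =>
    rw [select]
    split_ifs with hsmall
    · have hsort := cost_insertionSort_le x A
      rw [CmpProg.cost_bind, CmpProg.cost_pure]
      nlinarith
    have hM := groupMedians_subperm x A
    have hMnodup := nodup_eval_groupMedians x hA
    have hlenM := length_eval_groupMedians x A
    have hp := hasRank_select (x := x) (A := (groupMedians A).eval x) (k := A.length / 5 / 2) a
      (d := d) (by omega) hMnodup (by omega)
    have hgroups := cost_groupMedians_le x A
    have hmedian := ih (A := (groupMedians A).eval x) (A.length / 5 / 2) (by omega) hMnodup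
    simp only [CmpProg.cost_bind, eval_stablePartition, hlenM] at hmedian ⊢
    generalize (select a d (A.length / 5 / 2) ((groupMedians A).eval x)).eval x = p at *
    have hpart := cost_stablePartition_le x p A
    have hlen := length_lowerPart_add_length_upperPart x hA (hM.subset hp.1)
    have hlo := hp.ten_mul_length_lowerPart_le hA
    have hhi := hp.ten_mul_length_upperPart_le hA
    have hcostlo (k : ℕ) := ih k (by omega) (hA.sublist (lowerPart_sublist x p A))
    have hcosthi (k : ℕ) := ih k (by omega) (hA.sublist (upperPart_sublist x p A))
    split_ifs
    · specialize hcostlo k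
      omega
    · rw [CmpProg.cost_pure]
      omega
    · specialize hcosthi (k - (lowerPart x p A).length - 1)
      omega

end MedianOfMedians

theorem hasRank_medianPivot (x : Fin n → α) {a : Fin n} {l : List (Fin n)} (hA : (a :: l).Nodup) :
    HasRank x (a :: l) ((a :: l).length / 2) ((medianPivot n a l).eval x) :=
  hasRank_select a le_rfl hA (Nat.div_lt_self (Nat.succ_pos _) one_lt_two)

theorem isBalancedPivotRule_medianPivot : IsBalancedPivotRule.{u} medianPivot (1 / 2) 120 := by
  intro n α _ x a l hA
  have hp := hasRank_medianPivot x hA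
  have hupper := hp.length_upperPart hA
  have hlo : 2 * (lowerPart x ((medianPivot n a l).eval x) (a :: l)).length ≤ (a :: l).length := by
    rw [hp.2]
    omega
  have hhi : 2 * (upperPart x ((medianPivot n a l).eval x) (a :: l)).length ≤ (a :: l).length := by
    omega
  refine ⟨hp.1, ?_, ?_, mod_cast cost_select_le x a _ le_rfl hA⟩
  · rw [one_div, ← div_eq_inv_mul, le_div_iff₀' two_pos]
    exact_mod_cast hlo
  · rw [one_div, ← div_eq_inv_mul, le_div_iff₀' two_pos]
    exact_mod_cast hhi

end Selection

theorem mainTheorem1 :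
    -- correctness and comparison bound for every linear-cost balanced pivot rule
    (∀ β c : ℝ, β < 1 → ∃ C : ℝ, 0 < C ∧
      ∀ piv : PivotRule, IsBalancedPivotRule.{u} piv β c →
      ∀ (n : ℕ) (α : Type u) [LinearOrder α] (x : Fin n → α),
        ((partitionSort piv n).eval x).Perm (List.finRange n) ∧
        (((partitionSort piv n).eval x).map x).Pairwise (· ≤ ·) ∧
        ∀ P : Finpartition (Finset.univ : Finset (Fin n)),
          (∀ S ∈ P.parts, IsSortedSubseq x S) →
          ((partitionSort piv n).cost x : ℝ) ≤ C * sizeBound P ∧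
          ((partitionSort piv n).cost x : ℝ) ≤ C * ((n : ℝ) * sizeEntropy P + n)) ∧
    -- a linear-cost rule that always returns the median exists
    (∃ (piv : PivotRule) (c : ℝ), IsBalancedPivotRule.{u} piv (1 / 2) c) ∧
    -- the maximal sorted subsequences of an input partition it
    (∀ (n : ℕ) (α : Type u) [LinearOrder α] (x : Fin n → α),
      ∃ P : Finpartition (Finset.univ : Finset (Fin n)),
        ∀ S, S ∈ P.parts ↔ Maximal (IsSortedSubseq x) S) ∧
    -- the two bounds agree up to constant factors
    (∃ K : ℝ, 0 < K ∧ ∀ (n : ℕ) (P : Finpartition (Finset.univ : Finset (Fin n))),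
      sizeBound P ≤ K * ((n : ℝ) * sizeEntropy P + n) ∧
      (n : ℝ) * sizeEntropy P + n ≤ K * sizeBound P) := by
  refine ⟨fun β c hβ => ?_, ⟨medianPivot, 120, isBalancedPivotRule_medianPivot⟩,
    fun n α _ x => exists_finpartition_maximal_isSortedSubseq x,
    2, two_pos, fun n P => ⟨?_, mul_sizeEntropy_add_le_two_mul_sizeBound P⟩⟩
  · obtain ⟨C, hC, hcost⟩ := exists_cost_partitionSort_le.{u} hβ c
    refine ⟨C, hC, fun piv hpiv n α _ x => ?_⟩
    have hlen : (List.finRange n).length ≤ n := List.length_finRange.le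
    have hnodup := List.nodup_finRange n
    refine ⟨partitionSortAux_perm (hpiv.pivotOf_mem x) hlen hnodup, List.pairwise_map.2 <|
      partitionSortAux_pairwise_le (hpiv.pivotOf_mem x) hlen hnodup, fun P hP => ?_⟩
    have hbound := hcost piv hpiv n α x P hP
    exact ⟨hbound, hbound.trans <|
      mul_le_mul_of_nonneg_left (sizeBound_le_mul_sizeEntropy_add P) hC.le⟩
  · have hle := sizeBound_le_mul_sizeEntropy_add P
    have hnonneg := (Nat.cast_nonneg n).trans (le_sizeBound P)
    linarith
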